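/- **Definitions.** An *event-state structure* is a triple $(\mathcal E,\mathbb S,\mathbb P)$ of a set $\mathcal E$ of events, a set $\mathbb S$ of states and a function $\mathbb P:\mathcal E\times\mathbb S\to[0,1]$ such that, with $\mathbb S_1(E)=\{\rho:\mathbb P(E,\rho)=1\}$ and $\mathbb S_0(E)=\{\rho:\mathbb P(E,\rho)=0\}$: - (I.1) $\mathbb S_1(E_1)=\mathbb S_1(E_2)$ implies $E_1=E_2$; - (I.2) there is an event $\mathbf 1$ with $\mathbb S_1(\mathbf 1)=\mathbb S$; - (I.3) $\mathbb S_1(E_1)\subseteq\mathbb S_1(E_2)$ implies $\mathbb S_0(E_2)\subseteq\mathbb S_0(E_1)$; - (I.4) for every event $E$ there is an event $E'$ with $\mathbb S_1(E)=\mathbb S_0(E')$ and $\mathbb S_0(E)=\mathbb S_1(E')$; - (I.5) for every sequence of events $E_1,E_2,\dots$ with $\mathbb S_1(E_i)\subseteq\mathbb S_0(E_j)$ for $i\ne j$ there is an event $E$ such that $\mathbb S_1(E_i)\subseteq\mathbb S_1(E)$ for all $i$; $\mathbb S_1(E)\subseteq\mathbb S_1(F)$ for every event $F$ with $\mathbb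 S_1(E_i)\subseteq\mathbb S_1(F)$ for all $i$; and $\sum_i\mathbb P(E_i,\rho)=\mathbb P(E,\rho)$ for all $\rho\in\mathbb S$; - (I.6) if $\mathbb P(E,\rho_1)=\mathbb P(E,\rho_2)$ for all $E\in\mathcal E$, then $\rho_1=\rho_2$; - (I.7) for states $\rho_1,\rho_2,\dots$ and $t_i\in[0,1]$ with $\sum_i t_i=1$ there is a state $\rho$ with $\mathbb P(E,\rho)=\sum_i t_i\,\mathbb P(E,\rho_i)$ for all $E\in\mathcal E$. Events are partially ordered by $E_1\le E_2\iff\mathbb S_1(E_1)\subseteq\mathbb S_1(E_2)$. By (I.1) the certain event $\mathbf 1$ and the complement $E'$ are unique; put $\mathbf 0=\mathbf 1'$. The meet $\wedge$ and the join $\vee$ are the greatest lower bound and the least upper bound with respect to $\le$. Write $E_1\perp E_2$ for $E_1\le E_2'$. Events $E_1,E_2$ are *compatible* if there are pairwise orthogonal events $F_1,F_2,F_3$ with $E_1=F_1\vee F_3$ and $E_2=F_2\vee F_3$; the meet of two compatible events always exists. Let $\mathbb O$ be the set of maps $T:\mathbb D_T\to\mathbb S$ with $\mathbb D_T\subseteq\mathbb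 S$ (two such maps being equal iff they have the same domain and the same values), with composition $(T_1\circ T_2)(\rho)=T_1(T_2(\rho))$ on $\mathbb D_{T_1\circ T_2}=\{\rho\in\mathbb D_{T_2}:T_2(\rho)\in\mathbb D_{T_1}\}$. An *event-state-operation structure* $(\mathcal E,\mathbb S,\mathbb P,\mathbb T)$ is an event-state structure with a map $\mathbb T:\mathcal E\to\mathbb O$, $E\mapsto T_E$, such that, with $\mathbb O_{\mathbb T}=\{T_{E_1}\circ\cdots\circ T_{E_n}:n\ge1,\ E_i\in\mathcal E\}$: - (II.1) $\mathbb D_{T_E}=\mathbb D_E:=\{\rho:\mathbb P(E,\rho)\ne0\}$; - (II.2) if $\mathbb P(E,\rho)=1$, then $T_E(\rho)=\rho$; - (II.3) if $\rho\in\mathbb D_E$, then $\mathbb P(E,T_E(\rho))=1$; - (II.4) $T_{E_1}\circ\cdots\circ T_{E_n}=T_{F_1}\circ\cdots\circ T_{F_n}$ implies $T_{E_n}\circ\cdots\circ T_{E_1}=T_{F_n}\circ\cdots\circ T_{F_1}$; - (II.5) for every $T\in\mathbb O_{\mathbb T}$ there is an event $E_T$ (unique by (I.1)) with $\mathbb S_1(E_T)=\{\rho\in\mathbb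 S:\rho\notin\mathbb D_T\}$; - (II.6) if $E_2\le E_1$ and $\rho\in\mathbb D_{E_1}$, then $\mathbb P(E_2,T_{E_1}(\rho))=\mathbb P(E_2,\rho)/\mathbb P(E_1,\rho)$; - (II.7) if $E_1,E_2$ are compatible and $\rho\in\mathbb D_{E_1}$, then $\mathbb P(E_2,T_{E_1}(\rho))=\mathbb P(E_1\wedge E_2,T_{E_1}(\rho))$. For $T\in\mathbb O_{\mathbb T}$ put $T'=T_{E_T}\in\mathbb O_{\mathbb T}$. **Theorem.** Let $(\mathcal E,\mathbb S,\mathbb P,\mathbb T)$ be an event-state-operation structure. Then $(\mathcal E,\le,{}')$ is an ortholattice: $\mathbf 0$ and $\mathbf 1$ are its least and greatest elements, any two events have a meet and a join, and for all events $E,E_1,E_2$ one has $E''=E$, $E\wedge E'=\mathbf 0$, $E\vee E'=\mathbf 1$, and $E_1\le E_2$ implies $E_2'\le E_1'$. Moreover, for all $E_1,E_2\in\mathcal E$, $$T_{E_1\wedge E_2}=(T_{E_1'}\circ T_{E_2})'\circ T_{E_2}.$$ -/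

import Mathlib

universe u v

/-! ### Ortholattices -/

/-- An orthocomplementation on a partially ordered set `B` with least element `zero` and
greatest element `one`: an order-reversing involution `c` such that `p ∧ c p` and `p ∨ c p` exist
and equal `zero` and `one`, respectively. -/
structure IsOrthocomplementation {B : Type u} [PartialOrder B] (zero one : B) (c : B → B) :
    Prop where
  invol : ∀ p, c (c p) = p
  meet : ∀ p, IsGLB {p, c p} zero
  join : ∀ p, IsLUB {p, c p} one
  antitone : ∀ p q, p ≤ q → c q ≤ c p

/-- `(B, ≤, c)` is an ortholattice with least element `zero` and greatest element `one`: any two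
elements have a meet and a join, and `c` is an orthocomplementation. -/
structure IsOrtholattice {B : Type u} [PartialOrder B] (zero one : B) (c : B → B) : Prop where
  zero_le : ∀ p, zero ≤ p
  le_one : ∀ p, p ≤ one
  exists_meet : ∀ p q : B, ∃ r, IsGLB {p, q} r
  exists_join : ∀ p q : B, ∃ r, IsLUB {p, q} r
  orthocomplementation : IsOrthocomplementation zero one c

/-! ### Event-state structures -/

/-- `S₁(E)`: the states in which the event `E` occurs with certainty. -/
def certainStates {Event : Type u} {State : Type v} (P : Event → State → ℝ) (E : Event) :
    Set State :=
  {ρ | P E ρ = 1}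

/-- `S₀(E)`: the states in which the event `E` with certainty does not occur. -/
def impossibleStates {Event : Type u} {State : Type v} (P : Event → State → ℝ) (E : Event) :
    Set State :=
  {ρ | P E ρ = 0}

/-- An event-state structure: events, states, and a probability function with values in `[0, 1]`. -/
structure EventStateStructure where
  Event : Type u
  State : Type v
  P : Event → State → ℝ
  P_mem : ∀ E ρ, P E ρ ∈ Set.Icc (0 : ℝ) 1
  /-- An event is determined by the states in which it is certain. -/
  event_ext : ∀ E₁ E₂, certainStates P E₁ = certainStates P E₂ → E₁ = E₂
  /-- There is a certain event. -/
  exists_certain : ∃ E, certainStates P E = Set.univ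
  /-- `S₁(E₁) ⊆ S₁(E₂)` implies `S₀(E₂) ⊆ S₀(E₁)`. -/
  impossible_anti : ∀ E₁ E₂, certainStates P E₁ ⊆ certainStates P E₂ →
    impossibleStates P E₂ ⊆ impossibleStates P E₁
  /-- Every event has a complement. -/
  exists_compl : ∀ E, ∃ E', certainStates P E = impossibleStates P E' ∧
    impossibleStates P E = certainStates P E'
  /-- Countable additivity on pairwise orthogonal sequences of events. -/
  exists_countable_sum : ∀ E : ℕ → Event,
    (∀ i j, i ≠ j → certainStates P (E i) ⊆ impossibleStates P (E j)) →
    ∃ F, (∀ i, certainStates P (E i) ⊆ certainStates P F) ∧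
      (∀ G, (∀ i, certainStates P (E i) ⊆ certainStates P G) →
        certainStates P F ⊆ certainStates P G) ∧
      ∀ ρ, HasSum (fun i => P (E i) ρ) (P F ρ)
  /-- A state is determined by its probabilities. -/
  state_ext : ∀ ρ₁ ρ₂, (∀ E, P E ρ₁ = P E ρ₂) → ρ₁ = ρ₂
  /-- `σ`-convexity of the set of states. -/
  exists_mixture : ∀ (ρ : ℕ → State) (t : ℕ → ℝ), (∀ i, t i ∈ Set.Icc (0 : ℝ) 1) →
    HasSum t 1 → ∃ σ, ∀ E, HasSum (fun i => t i * P E (ρ i)) (P E σ)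

namespace EventStateStructure

variable (M : EventStateStructure.{u, v})

/-- The relation of implication: `E₁ ≤ E₂` iff `S₁(E₁) ⊆ S₁(E₂)`. -/
instance : PartialOrder M.Event where
  le E₁ E₂ := certainStates M.P E₁ ⊆ certainStates M.P E₂
  le_refl _ := Set.Subset.rfl
  le_trans _ _ _ h₁ h₂ := Set.Subset.trans h₁ h₂
  le_antisymm E₁ E₂ h₁ h₂ := M.event_ext E₁ E₂ (Set.Subset.antisymm h₁ h₂)

/-- The certain event. -/
noncomputable def one : M.Event := M.exists_certain.choose

theorem certainStates_one : certainStates M.P M.one = Set.univ := M.exists_certain.choose_spec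

/-- The complement (negation) `E'` of an event: the unique event with `S₁(E) = S₀(E')` and
`S₀(E) = S₁(E')`. -/
noncomputable def compl (E : M.Event) : M.Event := (M.exists_compl E).choose

theorem compl_spec (E : M.Event) :
    certainStates M.P E = impossibleStates M.P (M.compl E) ∧
      impossibleStates M.P E = certainStates M.P (M.compl E) :=
  (M.exists_compl E).choose_spec

theorem eq_compl {E F : M.Event} (h : impossibleStates M.P E = certainStates M.P F) :
    F = M.compl E :=
  M.event_ext _ _ (h.symm.trans (M.compl_spec E).2)

/-- The impossible event. -/
noncomputable def zero : M.Event := M.compl M.one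

theorem certainStates_zero : certainStates M.P M.zero = ∅ := by
  refine (M.compl_spec M.one).2.symm.trans (Set.eq_empty_iff_forall_notMem.2 fun ρ h₀ => ?_)
  have h₁ : ρ ∈ certainStates M.P M.one := by rw [M.certainStates_one]; trivial
  exact zero_ne_one (h₀.symm.trans h₁)

theorem impossibleStates_zero : impossibleStates M.P M.zero = Set.univ :=
  (M.compl_spec M.one).1.symm.trans M.certainStates_one

/-- Orthogonality of events: `E₁ ⊥ E₂` iff `E₁ ≤ E₂'`. -/
def Orthogonal (E₁ E₂ : M.Event) : Prop := E₁ ≤ M.compl E₂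

/-- Compatibility `E₁ C E₂`: there are pairwise orthogonal events `F₁, F₂, F₃` with
`E₁ = F₁ ∨ F₃` and `E₂ = F₂ ∨ F₃`. -/
def Compatible (E₁ E₂ : M.Event) : Prop :=
  ∃ F₁ F₂ F₃, M.Orthogonal F₁ F₂ ∧ M.Orthogonal F₁ F₃ ∧ M.Orthogonal F₂ F₃ ∧
    IsLUB {F₁, F₃} E₁ ∧ IsLUB {F₂, F₃} E₂

end EventStateStructure

/-! ### Operations

Partial maps of the set of states into itself are `State →. State`; `σ ∈ T ρ` says that `ρ` lies
in the domain of `T` and `T(ρ) = σ`, and `T₁.comp T₂` has the domain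
`{ρ ∈ D(T₂) | T₂(ρ) ∈ D(T₁)}`. -/

/-- The composition `T(E₁) ∘ T(E₂) ∘ ⋯ ∘ T(Eₙ)` for a list `[E₁, E₂, …, Eₙ]` (the operation
`T(Eₙ)` is performed first; the identity for the empty list). -/
def composeList {Event : Type u} {State : Type v} (T : Event → (State →. State)) :
    List Event → (State →. State)
  | [] => PFun.id State
  | E :: L => (T E).comp (composeList T L)

/-- Membership in `O_T`: `U = T(E₁) ∘ ⋯ ∘ T(Eₙ)` for some `n ≥ 1` and events `E₁, …, Eₙ`. -/
def IsOperation {Event : Type u} {State : Type v} (T : Event → (State →. State))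
    (U : State →. State) : Prop :=
  ∃ L : List Event, L ≠ [] ∧ U = composeList T L

/-- The axioms for a map `E ↦ T(E)` from the events of an event-state structure to the
partial maps on its states. -/
structure OperationAxioms (M : EventStateStructure.{u, v}) (T : M.Event → (M.State →. M.State)) :
    Prop where
  /-- The domain of `T(E)` is the set of states in which `E` has non-zero probability. -/
  dom_T : ∀ E, (T E).Dom = {ρ | M.P E ρ ≠ 0}
  /-- `T(E)` fixes the states in which `E` is certain. -/
  T_of_certain : ∀ E ρ, M.P E ρ = 1 → ρ ∈ T E ρ
  /-- `E` is certain in every state `T(E)(ρ)`. -/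
  certain_of_T : ∀ E ρ σ, σ ∈ T E ρ → M.P E σ = 1
  /-- Equality of two compositions of `n` maps `T(E)` persists when both orders are reversed. -/
  reverse_eq : ∀ L K : List M.Event, L.length = K.length →
    composeList T L = composeList T K → composeList T L.reverse = composeList T K.reverse
  /-- The states outside the domain of an operation are those in which some event is certain. -/
  exists_event : ∀ U, IsOperation T U → ∃ E, certainStates M.P E = {ρ | ρ ∉ U.Dom}
  /-- Conditional probability of an event `E₂ ≤ E₁`. -/
  P_T_of_le : ∀ E₁ E₂, E₂ ≤ E₁ → ∀ ρ σ, σ ∈ T E₁ ρ → M.P E₂ σ = M.P E₂ ρ / M.P E₁ ρ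
  /-- Conditional probability of an event `E₂` compatible with `E₁`, with `E = E₁ ∧ E₂` (the meet of
  two compatible events exists in every event-state structure). -/
  P_T_of_compatible : ∀ E₁ E₂ E, M.Compatible E₁ E₂ → IsGLB {E₁, E₂} E →
    ∀ ρ σ, σ ∈ T E₁ ρ → M.P E₂ σ = M.P E σ

/-- An event-state-operation structure: an event-state structure with a map `E ↦ T(E)` from events
to partial maps on states that satisfies the operation axioms. -/
structure EventStateOperationStructure extends EventStateStructure.{u, v} where
  T : Event → (State →. State)
  operationAxioms : OperationAxioms toEventStateStructure T

namespace EventStateOperationStructure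

variable (M : EventStateOperationStructure.{u, v})

/-- The set `O_T` of operations. -/
def Operation : Type v := {U : M.State →. M.State // IsOperation M.T U}

/-- The operation `T(E)` corresponding to the event `E`. -/
def op (E : M.Event) : M.Operation :=
  ⟨M.T E, [E], List.cons_ne_nil _ _, (PFun.comp_id _).symm⟩

theorem composeList_append (T : M.Event → (M.State →. M.State)) (L K : List M.Event) :
    composeList T (L ++ K) = (composeList T L).comp (composeList T K) := by
  induction L with
  | nil => exact (PFun.id_comp _).symm
  | cons E L ih =>
    change (T E).comp (composeList T (L ++ K)) = ((T E).comp (composeList T L)).comp _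
    rw [ih, PFun.comp_assoc]

variable {M}

/-- The composition `U ∘ V` of operations (`V` is performed first). -/
def Operation.comp (U V : M.Operation) : M.Operation :=
  ⟨U.1.comp V.1, by
    obtain ⟨_, L, hL, rfl⟩ := U
    obtain ⟨_, K, _, rfl⟩ := V
    exact ⟨L ++ K, List.append_ne_nil_of_left_ne_nil hL K, (M.composeList_append _ L K).symm⟩⟩

/-- The event `E_U` of an operation `U`: the unique event that occurs with certainty in exactly
the states outside the domain of `U`. -/
noncomputable def Operation.event (U : M.Operation) : M.Event := (M.operationAxioms.exists_event U.1 U.2).choose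

theorem Operation.certainStates_event (U : M.Operation) :
    certainStates M.P U.event = {ρ | ρ ∉ U.1.Dom} :=
  (M.operationAxioms.exists_event U.1 U.2).choose_spec

/-- The map `U ↦ U'` on `O_T`: `U' = T(E_U)`. -/
noncomputable def Operation.orth (U : M.Operation) : M.Operation := M.op U.event

end EventStateOperationStructure

/-!
The operations form a Baer `*`-semigroup, and the theorem is the description, due to Foulis, of
meets of closed projections in such a semigroup.

* The partial map `T(0)` has empty domain and is the zero of the semigroup. For an operation `U`
  and any partial map `V`, `U ∘ V = T(0)` means that the range of `V` avoids the domain of `U`,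
  i.e. lies in `S₁(E_U)`, i.e. `T(E_U) ∘ V = V` (`comp_eq_T_zero_iff`).
* The range of `T(F)` is `S₁(F)`, so `F ≤ E` is equivalent to `T(E) ∘ T(F) = T(F)` (`le_iff_comp`).
* Reversal of products is an involution on operations that fixes each `T(E)`. It turns a relation
  about the range of a product into one about the domain of the reversed product (`reverse_three`).

Let `G` be the event of `T(E₁') ∘ T(E₂)`. Since `T(E₁') ∘ T(E₂)` annihilates `T(G)`, it also
annihilates `T(E₂) ∘ T(G)`, so `T(G) ∘ T(E₂) ∘ T(G) = T(E₂) ∘ T(G)`; reversing shows that `T(G)` and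
`T(E₂)` commute (`T_comm_of_annihilates`). A product of commuting `T(G)`, `T(E₂)` is again of the form
`T(H)`, where `H ≤ G` and `H ≤ E₂` (`exists_T_eq_comp`), and the annihilation property of `G`
identifies `H` as the meet of `E₁` and `E₂` (`exists_isGLB_and_T_eq`). Joins follow by
complementation.
-/

namespace EventStateStructure

variable (M : EventStateStructure.{u, v})

theorem compl_compl (E : M.Event) : M.compl (M.compl E) = E :=
  (M.eq_compl (M.compl_spec E).1.symm).symm

theorem compl_le_compl {E F : M.Event} (h : E ≤ F) : M.compl F ≤ M.compl E := by
  change certainStates M.P (M.compl F) ⊆ certainStates M.P (M.compl E)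
  rw [← (M.compl_spec F).2, ← (M.compl_spec E).2]
  exact M.impossible_anti E F h

theorem compl_le_comm {E F : M.Event} : M.compl E ≤ F ↔ M.compl F ≤ E :=
  ⟨fun h => M.compl_compl E ▸ M.compl_le_compl h, fun h => M.compl_compl F ▸ M.compl_le_compl h⟩

theorem P_compl_eq_one_iff {E : M.Event} {ρ : M.State} : M.P (M.compl E) ρ = 1 ↔ M.P E ρ = 0 :=
  (Set.ext_iff.1 (M.compl_spec E).2 ρ).symm

theorem zero_le (E : M.Event) : M.zero ≤ E := by
  change certainStates M.P M.zero ⊆ _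
  rw [M.certainStates_zero]
  exact Set.empty_subset _

theorem le_one (E : M.Event) : E ≤ M.one := by
  change _ ⊆ certainStates M.P M.one
  rw [M.certainStates_one]
  exact Set.subset_univ _

theorem isGLB_pair_iff {E F G : M.Event} :
    IsGLB {E, F} G ↔ G ≤ E ∧ G ≤ F ∧ ∀ H, H ≤ E → H ≤ F → H ≤ G := by
  simp [IsGLB, IsGreatest, lowerBounds, upperBounds, and_assoc]

theorem isLUB_pair_of_isGLB_compl {E F G : M.Event} (h : IsGLB {M.compl E, M.compl F} G) :
    IsLUB {E, F} (M.compl G) := by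
  obtain ⟨hE, hF, hG⟩ := M.isGLB_pair_iff.1 h
  constructor
  · rintro _ (rfl | rfl)
    · exact (M.compl_compl _).ge.trans (M.compl_le_compl hE)
    · exact (M.compl_compl _).ge.trans (M.compl_le_compl hF)
  · intro H hH
    exact M.compl_le_comm.2 (hG _ (M.compl_le_compl (hH (by simp)))
      (M.compl_le_compl (hH (by simp))))

theorem isGLB_compl (E : M.Event) : IsGLB {E, M.compl E} M.zero := by
  refine M.isGLB_pair_iff.2 ⟨M.zero_le _, M.zero_le _, fun H hE hE' ρ hρ => ?_⟩
  have h₁ : M.P E ρ = 1 := hE hρ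
  have h₀ : M.P E ρ = 0 := M.P_compl_eq_one_iff.1 (hE' hρ)
  exact absurd (h₀.symm.trans h₁) zero_ne_one

theorem isOrthocomplementation_compl : IsOrthocomplementation M.zero M.one M.compl where
  invol := M.compl_compl
  meet := M.isGLB_compl
  join E := by
    have h := M.isLUB_pair_of_isGLB_compl (M.isGLB_compl (M.compl E))
    rwa [zero, M.compl_compl] at h
  antitone _ _ := M.compl_le_compl

end EventStateStructure

namespace EventStateOperationStructure

variable (M : EventStateOperationStructure.{u, v})

theorem mem_dom_T {E : M.Event} {ρ : M.State} : ρ ∈ (M.T E).Dom ↔ M.P E ρ ≠ 0 := by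
  rw [M.operationAxioms.dom_T]
  rfl

theorem mem_comp_iff {α β γ : Type*} {f : β →. γ} {g : α →. β} {a : α} {c : γ} :
    c ∈ f.comp g a ↔ ∃ b ∈ g a, c ∈ f b :=
  Part.mem_bind_iff

/-- `T(F) ∘ V = V` exactly when `F` is certain throughout the range of `V`. -/
theorem T_comp_eq_self_iff {F : M.Event} {V : M.State →. M.State} :
    (M.T F).comp V = V ↔ ∀ ρ, ∀ σ ∈ V ρ, M.P F σ = 1 := by
  constructor
  · intro h ρ σ hσ
    rw [← h, mem_comp_iff] at hσ
    obtain ⟨τ, -, hτ⟩ := hσ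
    exact M.operationAxioms.certain_of_T F τ σ hτ
  · intro h
    ext ρ σ
    rw [mem_comp_iff]
    constructor
    · rintro ⟨τ, hτ, hσ⟩
      rwa [Part.mem_unique hσ (M.operationAxioms.T_of_certain F τ (h ρ τ hτ))]
    · exact fun hσ => ⟨σ, hσ, M.operationAxioms.T_of_certain F σ (h ρ σ hσ)⟩

theorem le_iff_comp {E F : M.Event} : F ≤ E ↔ (M.T E).comp (M.T F) = M.T F := by
  rw [T_comp_eq_self_iff]
  exact ⟨fun h ρ σ hσ => h (M.operationAxioms.certain_of_T F ρ σ hσ),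
    fun h ρ hρ => h ρ ρ (M.operationAxioms.T_of_certain F ρ hρ)⟩

theorem T_comp_self (E : M.Event) : (M.T E).comp (M.T E) = M.T E :=
  M.le_iff_comp.1 le_rfl

theorem notMem_T_zero (ρ σ : M.State) : σ ∉ M.T M.zero ρ := fun h =>
  M.mem_dom_T.1 ((PFun.mem_dom _ _).2 ⟨σ, h⟩)
    (Set.eq_univ_iff_forall.1 M.impossibleStates_zero ρ)

theorem comp_eq_T_zero_iff_forall {U V : M.State →. M.State} :
    U.comp V = M.T M.zero ↔ ∀ ρ, ∀ σ ∈ V ρ, σ ∉ U.Dom := by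
  constructor
  · intro h ρ σ hσ hU
    obtain ⟨τ, hτ⟩ := (PFun.mem_dom _ _).1 hU
    refine M.notMem_T_zero ρ τ ?_
    rw [← h, mem_comp_iff]
    exact ⟨σ, hσ, hτ⟩
  · intro h
    ext ρ τ
    rw [mem_comp_iff]
    constructor
    · rintro ⟨σ, hσ, hτ⟩
      exact absurd ((PFun.mem_dom _ _).2 ⟨τ, hτ⟩) (h ρ σ hσ)
    · exact fun hτ => absurd hτ (M.notMem_T_zero ρ τ)

theorem comp_T_zero (U : M.State →. M.State) : U.comp (M.T M.zero) = M.T M.zero :=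
  M.comp_eq_T_zero_iff_forall.2 fun ρ σ hσ => absurd hσ (M.notMem_T_zero ρ σ)

/-- The Baer property: the right annihilator of `U` consists of the `V` with `T(E_U) ∘ V = V`. -/
theorem comp_eq_T_zero_iff (U : M.Operation) {V : M.State →. M.State} :
    U.1.comp V = M.T M.zero ↔ (M.T U.event).comp V = V := by
  rw [comp_eq_T_zero_iff_forall, T_comp_eq_self_iff]
  exact forall₃_congr fun ρ σ _ => (Set.ext_iff.1 U.certainStates_event σ).symm

theorem T_comp_eq_T_zero_iff {E : M.Event} {V : M.State →. M.State} :
    (M.T E).comp V = M.T M.zero ↔ (M.T (M.compl E)).comp V = V := by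
  rw [comp_eq_T_zero_iff_forall, T_comp_eq_self_iff]
  refine forall₃_congr fun ρ σ _ => ?_
  rw [mem_dom_T, not_not, M.P_compl_eq_one_iff]

theorem T_comp_T_compl (E : M.Event) : (M.T E).comp (M.T (M.compl E)) = M.T M.zero :=
  M.T_comp_eq_T_zero_iff.2 (M.T_comp_self _)

theorem reverse_three {A B C D E F : M.Event}
    (h : (M.T A).comp ((M.T B).comp (M.T C)) = (M.T D).comp ((M.T E).comp (M.T F))) :
    (M.T C).comp ((M.T B).comp (M.T A)) = (M.T F).comp ((M.T E).comp (M.T D)) := by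
  simpa [composeList, PFun.comp_id] using M.operationAxioms.reverse_eq [A, B, C] [D, E, F] rfl
    (by simpa [composeList, PFun.comp_id] using h)

/-- If `T(F)` leaves `T(E) ∘ T(F)` invariant on the left, then `T(E)` and `T(F)` commute: the
left-hand side of the hypothesis is fixed under reversal. -/
theorem T_comm_of_comp_comp {E F : M.Event}
    (h : (M.T F).comp ((M.T E).comp (M.T F)) = (M.T E).comp (M.T F)) :
    (M.T F).comp (M.T E) = (M.T E).comp (M.T F) := by
  have h' : (M.T F).comp ((M.T E).comp (M.T F)) = (M.T E).comp ((M.T F).comp (M.T F)) := by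
    rw [h, M.T_comp_self]
  rw [← h, M.reverse_three h', ← PFun.comp_assoc, M.T_comp_self]

/-- The product of commuting `T(F)` and `T(E)` is `T(H)` for an event `H` below both. Here `H` is
the complement of the event `K` of the product. -/
theorem exists_T_eq_comp {E F : M.Event} (h : (M.T F).comp (M.T E) = (M.T E).comp (M.T F)) :
    ∃ H, H ≤ E ∧ H ≤ F ∧ M.T H = (M.T F).comp (M.T E) := by
  let Q : M.Operation := (M.op F).comp (M.op E)
  let K : M.Event := Q.event
  have hQ {V : M.State →. M.State} :
      (M.T F).comp ((M.T E).comp V) = M.T M.zero ↔ (M.T K).comp V = V := by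
    rw [← PFun.comp_assoc]
    exact M.comp_eq_T_zero_iff Q
  have hE : M.compl K ≤ E := by
    rw [M.compl_le_comm, le_iff_comp, ← hQ, T_comp_T_compl, comp_T_zero]
  have hF : M.compl K ≤ F := by
    rw [M.compl_le_comm, le_iff_comp, ← hQ, ← PFun.comp_assoc, h, PFun.comp_assoc,
      T_comp_T_compl, comp_T_zero]
  refine ⟨M.compl K, hE, hF, ?_⟩
  -- Reversing `T(F) ∘ T(E) ∘ T(K) = T(0)` shows that `K'` is certain on the range of the product.
  have h₀ : (M.T K).comp ((M.T E).comp (M.T F)) = M.T M.zero := by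
    have h₁ := M.reverse_three (D := M.zero) (E := M.zero) (F := M.zero)
      ((hQ.2 (M.T_comp_self K)).trans (by simp only [comp_T_zero]))
    rwa [comp_T_zero, comp_T_zero] at h₁
  -- Reversing once more gives `T(F) ∘ T(E) ∘ T(K') = T(F) ∘ T(E)`, whose left side is `T(K')`.
  have h₂ : (M.T (M.compl K)).comp ((M.T E).comp (M.T F)) =
      (M.T E).comp ((M.T E).comp (M.T F)) := by
    rw [M.T_comp_eq_T_zero_iff.1 h₀, ← PFun.comp_assoc, M.T_comp_self]
  have h₃ := M.reverse_three h₂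
  rwa [M.le_iff_comp.1 hE, M.le_iff_comp.1 hF, M.T_comp_self] at h₃

/-- If `G` is the event of `U ∘ T(E)`, then `T(G)` and `T(E)` commute. -/
theorem T_comm_of_annihilates (U : M.Operation) (E : M.Event) :
    (M.T (U.comp (M.op E)).event).comp (M.T E) =
      (M.T E).comp (M.T (U.comp (M.op E)).event) := by
  refine M.T_comm_of_comp_comp ((M.comp_eq_T_zero_iff _).1 ?_)
  have h := (M.comp_eq_T_zero_iff (U.comp (M.op E))).2 (M.T_comp_self _)
  change (U.1.comp (M.T E)).comp _ = _ at h ⊢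
  rwa [← PFun.comp_assoc, PFun.comp_assoc U.1, M.T_comp_self]

theorem exists_isGLB_and_T_eq (E₁ E₂ : M.Event) :
    ∃ H, IsGLB {E₁, E₂} H ∧
      M.T H = (M.T ((M.op (M.compl E₁)).comp (M.op E₂)).event).comp (M.T E₂) := by
  let U : M.Operation := (M.op (M.compl E₁)).comp (M.op E₂)
  have hU {V : M.State →. M.State} :
      (M.T (M.compl E₁)).comp ((M.T E₂).comp V) = M.T M.zero ↔ (M.T U.event).comp V = V := by
    rw [← PFun.comp_assoc]
    exact M.comp_eq_T_zero_iff U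
  obtain ⟨H, hE, hG, hH⟩ := M.exists_T_eq_comp (M.T_comm_of_annihilates (M.op (M.compl E₁)) E₂)
  refine ⟨H, M.isGLB_pair_iff.2 ⟨?_, hE, fun F h₁ h₂ => ?_⟩, hH⟩
  · have h := hU.2 (M.le_iff_comp.1 hG)
    rw [M.le_iff_comp.1 hE, T_comp_eq_T_zero_iff, M.compl_compl] at h
    exact M.le_iff_comp.2 h
  · have h : (M.T U.event).comp (M.T F) = M.T F := by
      rw [← hU, M.le_iff_comp.1 h₂, T_comp_eq_T_zero_iff, M.compl_compl]
      exact M.le_iff_comp.1 h₁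
    rw [le_iff_comp, hH, PFun.comp_assoc, M.le_iff_comp.1 h₂]
    exact h

end EventStateOperationStructure

theorem mainTheorem1 (M : EventStateOperationStructure.{u, v}) :
    IsOrtholattice M.zero M.one M.compl ∧
      ∀ E₁ E₂ E : M.Event, IsGLB {E₁, E₂} E →
        M.op E = (((M.op (M.compl E₁)).comp (M.op E₂)).orth).comp (M.op E₂) := by
  refine ⟨⟨M.zero_le, M.le_one, fun E F => ?_, fun E F => ?_, M.isOrthocomplementation_compl⟩,
    fun E₁ E₂ E hE => ?_⟩
  · exact (M.exists_isGLB_and_T_eq E F).imp fun _ h => h.1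
  · obtain ⟨G, hG, -⟩ := M.exists_isGLB_and_T_eq (M.compl E) (M.compl F)
    exact ⟨_, M.isLUB_pair_of_isGLB_compl hG⟩
  · obtain ⟨H, hH, hT⟩ := M.exists_isGLB_and_T_eq E₁ E₂
    rw [hE.unique hH]
    exact Subtype.ext hT
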